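/- Let $n, m \ge 1$ be integers, and let $G_n^\infty$ be the graph with vertex set $\mathbb{Z}^n$ in which $x$ and $y$ are adjacent if and only if $\|x-y\|_\infty = 1$. For a graph $G$ with vertex set $V$ and an integer $k \ge 1$, a function $f \colon V \to \{1,\dots,k\}$ is an $m$-distance clustered $k$-coloring of $G$ with constant $K$ (a positive integer) if, for every color $i$, every connected component of the subgraph of $G$ induced by $f^{-1}(\{i\})$ has at most $K$ vertices, and any two distinct such components (of the same color $i$) are at distance greater than $m$ in $G$. The $m$-distance clustered chromatic number $\chi_{\star,m}(G)$ is the least $k \ge 1$ such that $G$ has an $m$-distance clustered $k$-coloring with some constant $K$, and $\infty$ if there is no such $k$. If $\chi_{\star,m}(G) < \infty$, then $\widehat{K}_{\star,m}(G)$ denotes the least positive integer $K$ for which $G$ has an $m$-distance clustered $\chi_{\star,m}(G)$-coloring with constant $K$. Then $$\chi_{\star,m}(G_n^\infty) = n+1 \qquad\text{and}\qquad \widehat{K}_{\star,m}(G_n^\infty) \le n!\, m^n .$$ -/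

import Mathlib

/-- The distance in `G` between two sets of vertices: the infimum of the graph distances
between their points (`⊤` if no point of `A` can be joined to a point of `B`). -/
noncomputable def setEDist {V : Type*} (G : SimpleGraph V) (A B : Set V) : ℕ∞ :=
  ⨅ x ∈ A, ⨅ y ∈ B, G.edist x y

/-- The set of vertices of `G` that make up the connected component `C` of the subgraph
induced by `s`. -/
def componentVertices {V : Type*} {G : SimpleGraph V} {s : Set V}
    (C : (G.induce s).ConnectedComponent) : Set V :=
  (fun v : s => (v : V)) '' C.supp

/-- `f` is an `m`-distance clustered `k`-coloring of `G` with the constant `K`: for every color,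
all connected components of the subgraph induced by the color class have at most `K` vertices,
and any two different components are at distance (in `G`) bigger than `m`. -/
def IsClusteredColoringWith {V : Type*} (G : SimpleGraph V) (m k K : ℕ) (f : V → Fin k) : Prop :=
  ∀ i : Fin k,
    (∀ C : (G.induce (f ⁻¹' {i})).ConnectedComponent, (componentVertices C).encard ≤ (K : ℕ∞)) ∧
    (∀ C D : (G.induce (f ⁻¹' {i})).ConnectedComponent, C ≠ D →
      (m : ℕ∞) < setEDist G (componentVertices C) (componentVertices D))

/-- `f` is an `m`-distance clustered `k`-coloring of `G`. -/
def IsClusteredColoring {V : Type*} (G : SimpleGraph V) (m k : ℕ) (f : V → Fin k) : Prop :=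
  ∃ K : ℕ, 0 < K ∧ IsClusteredColoringWith G m k K f

/-- The `m`-distance clustered chromatic number of `G`: the minimum natural number `k ≥ 1` for
which there is an `m`-distance clustered `k`-coloring of `G`, and `⊤` if there is none. -/
noncomputable def clusteredChromaticNumber {V : Type*} (G : SimpleGraph V) (m : ℕ) : ℕ∞ :=
  ⨅ k ∈ {k : ℕ | 1 ≤ k ∧ ∃ f : V → Fin k, IsClusteredColoring G m k f}, (k : ℕ∞)

/-- The optimal cluster size of `G`: the minimum constant `K > 0` that is admissible for some
`m`-distance clustered coloring of `G` whose number of colors is the `m`-distance clustered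
chromatic number of `G`. An infimum over the empty set is `⊤`, so that a finite value is
attained. -/
noncomputable def optimalClusterSize {V : Type*} (G : SimpleGraph V) (m : ℕ) : ℕ∞ :=
  ⨅ K ∈ {K : ℕ | 0 < K ∧ ∃ k : ℕ, (k : ℕ∞) = clusteredChromaticNumber G m ∧
    ∃ f : V → Fin k, IsClusteredColoringWith G m k K f}, (K : ℕ∞)

/-- The king-move graph on `ℤⁿ`: two points are adjacent iff their `ℓ^∞`-distance is `1`.
(The norm of `Fin n → ℤ` is the sup norm.) -/
def kingGraph (n : ℕ) : SimpleGraph (Fin n → ℤ) where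
  Adj x y := ‖x - y‖ = 1
  symm := ⟨fun x y h => by rw [norm_sub_rev]; exact h⟩
  loopless := ⟨fun x h => by simp at h⟩

/-! Upper bound: boxes are built by induction on the dimension. In dimension `n`, cut each line in
the new direction into intervals of length `n * m`, coloured cyclically with `n + 1` colours, and
shift the lines over a box of old colour `c` by `m * (n + 1) * c`. The period is `n * (m * (n +
1))`, so the `n` old colours use up the shifts, and intervals of one colour start at distinct
multiples of `m * (n + 1)` up to a common offset. This leaves gaps exceeding `m`
(`lt_abs_sub_of_emod_ediv`). Box sizes multiply to `n! * m ^ n`.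

Lower bound: if clusters have at most `K` points, label a point of `[0, K]ⁿ` by the first coordinate
in which its cluster reaches a value `≤ 0`, or by `n` if there is none. This is a Sperner labelling,
so some simplex carries all `n + 1` labels (`exists_fully_labelled_simplex`). Labels are constant on
clusters and vertices of a simplex are king-adjacent or equal, so its `n + 1` vertices have
different colours. Sperner's lemma is proved by counting mod `2` on boundaries of chains. -/

/-! ### Metric and connectivity facts about the king graph. -/

theorem kingGraph_adj_iff {n : ℕ} {x y : Fin n → ℤ} :
    (kingGraph n).Adj x y ↔ x ≠ y ∧ ∀ i, |x i - y i| ≤ 1 := by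
  have key : ‖x - y‖ ≤ 1 ↔ ∀ i, |x i - y i| ≤ 1 := by
    rw [pi_norm_le_iff_of_nonneg zero_le_one]
    refine forall_congr' fun i => ?_
    rw [Pi.sub_apply, Int.norm_eq_abs]
    exact_mod_cast Iff.rfl
  change ‖x - y‖ = 1 ↔ _
  constructor
  · intro h
    refine ⟨fun e => by simp [e] at h, key.1 h.le⟩
  · rintro ⟨hne, h⟩
    refine le_antisymm (key.2 h) ?_
    obtain ⟨i, hi⟩ := Function.ne_iff.1 hne
    refine le_trans ?_ (norm_le_pi_norm (x - y) i)
    rw [Pi.sub_apply, Int.norm_eq_abs]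
    exact_mod_cast Int.one_le_abs (sub_ne_zero.2 hi)

theorem abs_sub_le_length_of_walk {n : ℕ} {x y : Fin n → ℤ} (p : (kingGraph n).Walk x y)
    (i : Fin n) : |x i - y i| ≤ p.length := by
  induction p with
  | nil => simp
  | @cons u v w h p ih =>
    have h1 := (kingGraph_adj_iff.1 h).2 i
    have h2 := abs_sub_le (u i) (v i) (w i)
    rw [SimpleGraph.Walk.length_cons]
    push_cast
    linarith

theorem lt_edist_kingGraph {n m : ℕ} {x y : Fin n → ℤ} {i : Fin n}
    (h : (m : ℤ) < |x i - y i|) : (m : ℕ∞) + 1 ≤ (kingGraph n).edist x y := by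
  refine le_iInf fun p => ?_
  have := abs_sub_le_length_of_walk p i
  have h2 : m + 1 ≤ p.length := by omega
  exact_mod_cast h2

/-- Vertices of an order-convex set of the lattice are joined by king moves inside the set. -/
theorem reachable_induce_of_between {n : ℕ} {s : Set (Fin n → ℤ)}
    (hs : ∀ x ∈ s, ∀ y ∈ s, ∀ z : Fin n → ℤ, (∀ i, z i ∈ Set.uIcc (x i) (y i)) → z ∈ s)
    (x y : s) : ((kingGraph n).induce s).Reachable x y := by
  obtain ⟨x, hx⟩ := x
  obtain ⟨y, hy⟩ := y
  obtain ⟨N, hN⟩ : ∃ N : ℕ, ∀ i, |x i - y i| ≤ N := by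
    refine ⟨∑ i, (x i - y i).natAbs, fun i => ?_⟩
    rw [Int.abs_eq_natAbs]
    exact_mod_cast Finset.single_le_sum (f := fun i => (x i - y i).natAbs)
      (fun _ _ => Nat.zero_le _) (Finset.mem_univ i)
  induction N generalizing x with
  | zero =>
    have : x = y := funext fun i => by
      have := hN i
      simp only [Nat.cast_zero, abs_nonpos_iff] at this
      omega
    subst this
    exact SimpleGraph.Reachable.refl _
  | succ N ih =>
    by_cases hxy : x = y
    · subst hxy
      exact SimpleGraph.Reachable.refl _
    -- One king move that brings every differing coordinate one step closer to `y`.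
    let z : Fin n → ℤ := fun i => if x i < y i then x i + 1 else if y i < x i then x i - 1 else x i
    have hzi : ∀ i, z i = if x i < y i then x i + 1 else if y i < x i then x i - 1 else x i :=
      fun i => rfl
    have hz : z ∈ s := by
      refine hs x hx y hy z fun i => ?_
      rw [Set.mem_uIcc, hzi]
      split_ifs <;> omega
    refine SimpleGraph.Reachable.trans (v := ⟨z, hz⟩) (SimpleGraph.Adj.reachable ?_)
      (ih z hz fun i => ?_)
    · rw [SimpleGraph.comap_adj]
      refine kingGraph_adj_iff.2 ⟨fun e => ?_, fun i => ?_⟩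
      · apply hxy
        funext i
        have : x i = z i := congrFun e i
        rw [hzi] at this
        split_ifs at this <;> omega
      · change |x i - z i| ≤ 1
        rw [hzi, abs_le]
        split_ifs <;> omega
    · have := hN i
      push_cast at this
      rw [abs_le] at this ⊢
      rw [hzi]
      split_ifs <;> omega

/-! ### Upper bound: the box colouring. -/

/-- Intervals of length `n * m` that are coloured cyclically with `n + 1` colours, where the rows
`c` and `d` are shifted by multiples of `m * (n + 1)`: two intervals of the same colour are more
than `m` apart. -/
theorem lt_abs_sub_of_emod_ediv {m n c d t s : ℤ} (hm : 0 < m) (hn : 0 < n)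
    (hc : 0 ≤ c) (hcn : c < n) (hd : 0 ≤ d) (hdn : d < n)
    (h : (t + m * (n + 1) * c) / (n * m) % (n + 1) = (s + m * (n + 1) * d) / (n * m) % (n + 1))
    (hne : ¬ (c = d ∧ (t + m * (n + 1) * c) / (n * m) = (s + m * (n + 1) * d) / (n * m))) :
    m < |t - s| := by
  have hw : 0 < n * m := mul_pos hn hm
  have h1 := Int.mul_ediv_add_emod (t + m * (n + 1) * c) (n * m)
  have h2 := Int.mul_ediv_add_emod (s + m * (n + 1) * d) (n * m)
  have a1 := Int.emod_nonneg (t + m * (n + 1) * c) hw.ne'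
  have a2 := Int.emod_nonneg (s + m * (n + 1) * d) hw.ne'
  have b1 := Int.emod_lt_of_pos (t + m * (n + 1) * c) hw
  have b2 := Int.emod_lt_of_pos (s + m * (n + 1) * d) hw
  generalize (t + m * (n + 1) * c) / (n * m) = p at *
  generalize (s + m * (n + 1) * d) / (n * m) = q at *
  generalize (t + m * (n + 1) * c) % (n * m) = e at *
  generalize (s + m * (n + 1) * d) % (n * m) = e' at *
  obtain ⟨z, hz⟩ := Int.ModEq.dvd h
  -- Since `|d - c| < n`, vanishing would force `z = 0`, hence the same shift and the same interval.
  have hu : d - c - n * z ≠ 0 := by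
    intro hu
    have hz0 : z = 0 := by
      by_contra hz0
      rcases lt_or_gt_of_ne hz0 with hlt | hlt
      · nlinarith
      · nlinarith
    subst hz0
    exact hne ⟨by linarith, by linarith⟩
  have hq : q = p + (n + 1) * z := by linarith
  subst hq
  -- The first term is at least `m * (n + 1)` in size and `|e - e'| < n * m`.
  have ht : t - s = m * (n + 1) * (d - c - n * z) + (e - e') := by linear_combination h2 - h1
  have hmn : 0 < m * (n + 1) := by positivity
  rw [ht, lt_abs]
  rcases lt_or_gt_of_ne hu with hlt | hlt
  · right
    have : m * (n + 1) * 1 ≤ m * (n + 1) * (-(d - c - n * z)) :=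
      mul_le_mul_of_nonneg_left (by omega) hmn.le
    linarith
  · left
    have : m * (n + 1) * 1 ≤ m * (n + 1) * (d - c - n * z) :=
      mul_le_mul_of_nonneg_left (by omega) hmn.le
    linarith

/-- A partition of the lattice into boxes with at most `n! * m ^ n` points, coloured with `n + 1`
colours so that different boxes of the same colour are more than `m` apart. -/
theorem exists_box_coloring (n m : ℕ) (hm : 1 ≤ m) :
    ∃ (β : Type) (B : (Fin n → ℤ) → β) (f : (Fin n → ℤ) → ℤ),
      (∀ x, 0 ≤ f x ∧ f x < n + 1) ∧
      (∀ x y, B x = B y → f x = f y) ∧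
      (∀ x y, f x = f y → B x ≠ B y → ∃ i, (m : ℤ) < |x i - y i|) ∧
      (∀ x y z : Fin n → ℤ, B x = B y → (∀ i, z i ∈ Set.uIcc (x i) (y i)) → B z = B x) ∧
      (∀ b, {x | B x = b}.encard ≤ ((n.factorial * m ^ n : ℕ) : ℕ∞)) := by
  induction n with
  | zero =>
    refine ⟨Unit, fun _ => (), fun _ => 0, by simp, by simp, by simp, by simp, fun b => ?_⟩
    simp only [Set.ofPred_true, Nat.factorial_zero, pow_zero, mul_one, Nat.cast_one]
    exact Set.encard_le_one_iff.2 fun a b _ _ => Subsingleton.elim a b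
  | succ n ih =>
    obtain ⟨β, B, f, hf, hBf, hfar, hconv, hcard⟩ := ih
    have hm' : (0 : ℤ) < m := by exact_mod_cast hm
    have hn' : (0 : ℤ) < (n : ℤ) + 1 := by positivity
    have hw : (0 : ℤ) < ((n : ℤ) + 1) * m := mul_pos hn' hm'
    let o : (Fin n → ℤ) → ℤ := fun x => m * ((n + 1 : ℤ) + 1) * f x
    let q : (Fin (n + 1) → ℤ) → ℤ := fun x => (x 0 + o (Fin.tail x)) / ((n + 1) * m)
    have hqo : ∀ x y : Fin (n + 1) → ℤ, ∀ t, f (Fin.tail x) = f (Fin.tail y) →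
        (t + o (Fin.tail x)) = t + o (Fin.tail y) := fun x y t h => by simp only [o, h]
    refine ⟨β × ℤ, fun x => (B (Fin.tail x), q x), fun x => q x % ((n + 1 : ℤ) + 1),
      fun x => ?_, fun x y h => ?_, fun x y h hne => ?_, fun x y z h hz => ?_, ?_⟩
    · push_cast
      exact ⟨Int.emod_nonneg _ (by positivity), Int.emod_lt_of_pos _ (by positivity)⟩
    · exact congrArg (· % ((n + 1 : ℤ) + 1)) (Prod.ext_iff.1 h).2
    -- Different boxes of one old colour are already far apart; otherwise the new coordinate
    -- separates the points.
    · by_cases hB : f (Fin.tail x) = f (Fin.tail y) ∧ B (Fin.tail x) ≠ B (Fin.tail y)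
      · obtain ⟨i, hi⟩ := hfar _ _ hB.1 hB.2
        exact ⟨i.succ, hi⟩
      · refine ⟨0, lt_abs_sub_of_emod_ediv hm' hn' (hf _).1 (hf _).2 (hf _).1 (hf _).2 h ?_⟩
        rintro ⟨h1, h2⟩
        exact hne (Prod.ext (not_not.1 fun h3 => hB ⟨h1, h3⟩) h2)
    · obtain ⟨h1, h2⟩ := Prod.ext_iff.1 h
      have hBz : B (Fin.tail z) = B (Fin.tail x) := hconv _ _ _ h1 fun i => hz i.succ
      refine Prod.ext hBz ?_
      change q z = q x
      replace h2 : q x = q y := h2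
      have e1 : q y = (y 0 + o (Fin.tail x)) / ((n + 1) * m) := by
        simp only [q, hqo x y _ (hBf _ _ h1)]
      have e2 : q z = (z 0 + o (Fin.tail x)) / ((n + 1) * m) := by
        simp only [q, hqo z x _ (hBf _ _ hBz)]
      have e3 : q x = (x 0 + o (Fin.tail x)) / ((n + 1) * m) := rfl
      rcases Set.mem_uIcc.1 (hz 0) with ⟨ha, hb⟩ | ⟨ha, hb⟩
      · apply le_antisymm
        · rw [h2, e1, e2]
          exact Int.ediv_le_ediv hw (by linarith)
        · rw [e2, e3]
          exact Int.ediv_le_ediv hw (by linarith)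
      · apply le_antisymm
        · rw [e2, e3]
          exact Int.ediv_le_ediv hw (by linarith)
        · rw [h2, e1, e2]
          exact Int.ediv_le_ediv hw (by linarith)
    · rintro ⟨b, k⟩
      rcases Set.eq_empty_or_nonempty {x : Fin (n + 1) → ℤ | (B (Fin.tail x), q x) = (b, k)} with
        h0 | ⟨x₀, hx₀⟩
      · rw [h0]
        simp
      obtain ⟨hb₀, -⟩ := Prod.ext_iff.1 hx₀
      set w : ℤ := ((n : ℤ) + 1) * m with hwdef
      have hI : ∀ c : ℤ, (Set.Ico (k * w - c) (k * w - c + w)).encard = ((n + 1) * m : ℕ) := by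
        intro c
        rw [← Finset.coe_Ico, Set.encard_coe_eq_coe_finsetCard, Int.card_Ico]
        rw [show k * w - c + w - (k * w - c) = (((n + 1) * m : ℕ) : ℤ) by
          rw [hwdef]; push_cast; ring, Int.toNat_natCast]
      calc _ ≤ ({y | B y = b} ×ˢ
              Set.Ico (k * w - o (Fin.tail x₀)) (k * w - o (Fin.tail x₀) + w)).encard := by
            refine Set.encard_le_encard_of_injOn (f := fun x => (Fin.tail x, x 0)) ?_ ?_
            · intro x hx
              obtain ⟨h1, h2⟩ := Prod.ext_iff.1 hx
              refine ⟨h1, ?_⟩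
              replace h2 : (x 0 + o (Fin.tail x)) / w = k := h2
              rw [hqo x x₀ _ (hBf _ _ (h1.trans hb₀.symm))] at h2
              have h3 := (Int.ediv_eq_iff_of_pos hw).1 h2
              rw [Set.mem_Ico]
              constructor <;> linarith
            · intro x _ y _ hxy
              obtain ⟨h1, h2⟩ := Prod.ext_iff.1 hxy
              rw [← Fin.cons_self_tail x, ← Fin.cons_self_tail y]
              simp only at h1 h2
              rw [h1, h2]
        _ ≤ ((n.factorial * m ^ n : ℕ) : ℕ∞) * (((n + 1) * m : ℕ) : ℕ∞) := by
            rw [Set.encard_prod, hI]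
            gcongr
            exact hcard b
        _ = _ := by
            rw [Nat.factorial_succ, pow_succ]
            norm_cast
            ring

/-- The monochromatic components are exactly the boxes: a king move is too short to join two boxes
of one colour as `m ≥ 1`, and order-convexity makes each box connected. -/
theorem exists_clusteredColoring_kingGraph (n m : ℕ) (hm : 1 ≤ m) :
    ∃ f : (Fin n → ℤ) → Fin (n + 1),
      IsClusteredColoringWith (kingGraph n) m (n + 1) (n.factorial * m ^ n) f := by
  obtain ⟨β, B, f, hf, hBf, hfar, hconv, hcard⟩ := exists_box_coloring n m hm
  let g : (Fin n → ℤ) → Fin (n + 1) := fun x =>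
    ⟨(f x).toNat, by have := hf x; omega⟩
  have hg : ∀ x y, g x = g y ↔ f x = f y := by
    intro x y
    rw [Fin.ext_iff]
    change (f x).toNat = (f y).toNat ↔ _
    have := hf x
    have := hf y
    omega
  have hreach : ∀ (i : Fin (n + 1)) (x y : g ⁻¹' {i}),
      ((kingGraph n).induce (g ⁻¹' {i})).Reachable x y → B x = B y := by
    rintro i x y ⟨p⟩
    induction p with
    | nil => rfl
    | @cons u v w h p ih =>
      rw [← ih]
      by_contra hne
      obtain ⟨j, hj⟩ := hfar u v ((hg _ _).1 (u.2.trans v.2.symm)) hne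
      have := (kingGraph_adj_iff.1 (SimpleGraph.comap_adj.1 h)).2 j
      have : (m : ℤ) < 1 := hj.trans_le this
      omega
  have hreach' : ∀ (i : Fin (n + 1)) (x y : g ⁻¹' {i}), B x = B y →
      ((kingGraph n).induce (g ⁻¹' {i})).Reachable x y := by
    intro i x y h
    have hsub : {z | B z = B x} ⊆ g ⁻¹' {i} := fun z hz =>
      ((hg _ _).2 (hBf _ _ hz)).trans x.2
    exact (reachable_induce_of_between (s := {z | B z = B x})
      (fun a ha b hb z hz => (hconv a b z (Eq.trans ha (Eq.symm hb)) hz).trans ha)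
      ⟨x, rfl⟩ ⟨y, h.symm⟩).map (SimpleGraph.induceHomOfLE _ hsub).toHom
  refine ⟨g, fun i => ⟨fun C => ?_, fun C D hCD => ?_⟩⟩
  · induction C using SimpleGraph.ConnectedComponent.ind with | _ x
    refine le_trans (Set.encard_le_encard ?_) (hcard (B x))
    rintro _ ⟨y, hy, rfl⟩
    exact hreach i y x (SimpleGraph.ConnectedComponent.exact hy)
  · refine lt_of_lt_of_le (b := (m : ℕ∞) + 1) (by exact_mod_cast Nat.lt_succ_self m) ?_
    refine le_iInf₂ fun x hx => le_iInf₂ fun y hy => ?_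
    obtain ⟨x, hx, rfl⟩ := hx
    obtain ⟨y, hy, rfl⟩ := hy
    obtain ⟨j, hj⟩ := hfar x y ((hg _ _).1 (x.2.trans y.2.symm)) fun h => hCD <| by
      rw [← (SimpleGraph.ConnectedComponent.mem_supp_iff _ _).1 hx,
        ← (SimpleGraph.ConnectedComponent.mem_supp_iff _ _).1 hy]
      exact SimpleGraph.ConnectedComponent.sound (hreach' i x y h)
    exact lt_edist_kingGraph hj

/-! ### Chains mod `2`, boundaries and prisms. -/

section Chains

variable {V : Type*}

/-- The chain with coefficients mod `2` that consists of the single simplex `l`. -/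
noncomputable def simplexChain (l : List V) : List V →₀ ZMod 2 := Finsupp.single l 1

/-- Adding a first vertex to all simplices of a chain. -/
noncomputable def coneMap (v : V) : (List V →₀ ZMod 2) →ₗ[ZMod 2] (List V →₀ ZMod 2) :=
  Finsupp.lmapDomain (ZMod 2) (ZMod 2) (List.cons v)

/-- Applying a map to all vertices of a chain. -/
noncomputable def vertexMap {W : Type*} (g : V → W) :
    (List V →₀ ZMod 2) →ₗ[ZMod 2] (List W →₀ ZMod 2) :=
  Finsupp.lmapDomain (ZMod 2) (ZMod 2) (List.map g)

/-- The (augmented) boundary of a simplex, mod `2`. -/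
noncomputable def simplexBoundary : List V → (List V →₀ ZMod 2)
  | [] => 0
  | v :: l => simplexChain l + coneMap v (simplexBoundary l)

/-- The boundary of a chain mod `2`. -/
noncomputable def chainBoundary : (List V →₀ ZMod 2) →ₗ[ZMod 2] (List V →₀ ZMod 2) :=
  Finsupp.linearCombination (ZMod 2) simplexBoundary

/-- The triangulated prism over a simplex, with bottom `g` and top `h`. -/
noncomputable def simplexPrism (g h : V → V) : List V → (List V →₀ ZMod 2)
  | [] => 0
  | v :: l => simplexChain (g v :: h v :: l.map h) + coneMap (g v) (simplexPrism g h l)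

/-- The triangulated prism over a chain, with bottom `g` and top `h`. -/
noncomputable def chainPrism (g h : V → V) : (List V →₀ ZMod 2) →ₗ[ZMod 2] (List V →₀ ZMod 2) :=
  Finsupp.linearCombination (ZMod 2) (simplexPrism g h)

@[simp] theorem coneMap_simplexChain (v : V) (l : List V) :
    coneMap v (simplexChain l) = simplexChain (v :: l) := by
  simp [coneMap, simplexChain]

@[simp] theorem vertexMap_simplexChain {W : Type*} (g : V → W) (l : List V) :
    vertexMap g (simplexChain l) = simplexChain (l.map g) := by
  simp [vertexMap, simplexChain]

@[simp] theorem chainBoundary_simplexChain (l : List V) :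
    chainBoundary (simplexChain l) = simplexBoundary l := by
  simp [chainBoundary, simplexChain]

@[simp] theorem chainPrism_simplexChain (g h : V → V) (l : List V) :
    chainPrism g h (simplexChain l) = simplexPrism g h l := by
  simp [chainPrism, simplexChain]

theorem chain_hom_ext {M : Type*} [AddCommMonoid M] [Module (ZMod 2) M]
    {φ ψ : (List V →₀ ZMod 2) →ₗ[ZMod 2] M}
    (h : ∀ l, φ (simplexChain l) = ψ (simplexChain l)) : φ = ψ :=
  Finsupp.lhom_ext' fun l => LinearMap.ext_ring (h l)

theorem chain_add_self (c : List V →₀ ZMod 2) : c + c = 0 := by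
  ext l
  exact CharTwo.add_self_eq_zero _

theorem chainBoundary_coneMap (v : V) (c : List V →₀ ZMod 2) :
    chainBoundary (coneMap v c) = c + coneMap v (chainBoundary c) := by
  have : chainBoundary ∘ₗ coneMap v = LinearMap.id + coneMap v ∘ₗ chainBoundary :=
    chain_hom_ext fun l => by simp [simplexBoundary]
  exact LinearMap.congr_fun this c

theorem chainPrism_coneMap (g h : V → V) (v : V) (c : List V →₀ ZMod 2) :
    chainPrism g h (coneMap v c) =
      coneMap (g v) (coneMap (h v) (vertexMap h c)) + coneMap (g v) (chainPrism g h c) := by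
  have : chainPrism g h ∘ₗ coneMap v =
      coneMap (g v) ∘ₗ coneMap (h v) ∘ₗ vertexMap h + coneMap (g v) ∘ₗ chainPrism g h :=
    chain_hom_ext fun l => by simp [simplexPrism]
  exact LinearMap.congr_fun this c

theorem simplexBoundary_map (h : V → V) (l : List V) :
    simplexBoundary (l.map h) = vertexMap h (simplexBoundary l) := by
  induction l with
  | nil => simp [simplexBoundary]
  | cons v l ih =>
    have : vertexMap h ∘ₗ coneMap v = coneMap (h v) ∘ₗ vertexMap h :=
      chain_hom_ext fun l => by simp
    have := LinearMap.congr_fun this (simplexBoundary l)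
    simp only [LinearMap.comp_apply] at this
    simp [simplexBoundary, ih, this]

/-- The chain homotopy formula: the boundary of a prism is bottom, top and sides, and signs are
absent mod `2`. -/
theorem chainBoundary_chainPrism (g h : V → V) (c : List V →₀ ZMod 2) :
    chainBoundary (chainPrism g h c) =
      vertexMap g c + vertexMap h c + chainPrism g h (chainBoundary c) := by
  have : chainBoundary ∘ₗ chainPrism g h =
      vertexMap g + vertexMap h + chainPrism g h ∘ₗ chainBoundary := by
    refine chain_hom_ext fun l => ?_
    simp only [LinearMap.comp_apply, LinearMap.add_apply, chainPrism_simplexChain,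
      vertexMap_simplexChain, chainBoundary_simplexChain]
    induction l with
    | nil => simp [simplexPrism, simplexBoundary, chain_add_self]
    | cons v l ih =>
      simp only [simplexPrism, simplexBoundary, map_add, chainBoundary_simplexChain,
        chainBoundary_coneMap, ih, chainPrism_simplexChain, chainPrism_coneMap,
        simplexBoundary_map, coneMap_simplexChain, List.map_cons]
      have e1 := chain_add_self (coneMap (g v) (simplexChain (l.map h)))
      rw [coneMap_simplexChain] at e1
      linear_combination (norm := abel) e1
  exact LinearMap.congr_fun this c

/-! ### Counting labelled simplices. -/

/-- The number mod `2` of the simplices of a chain whose vertices have the labels `s`. -/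
noncomputable def labelCount (lab : V → ℕ) (s : Multiset ℕ) :
    (List V →₀ ZMod 2) →ₗ[ZMod 2] ZMod 2 :=
  Finsupp.linearCombination (ZMod 2) fun l =>
    if ((l.map lab : List ℕ) : Multiset ℕ) = s then 1 else 0

theorem labelCount_simplexChain (lab : V → ℕ) (s : Multiset ℕ) (l : List V) :
    labelCount lab s (simplexChain l) =
      if ((l.map lab : List ℕ) : Multiset ℕ) = s then 1 else 0 := by
  simp [labelCount, simplexChain]

theorem labelCount_coneMap (lab : V → ℕ) (s : Multiset ℕ) (v : V) (c : List V →₀ ZMod 2) :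
    labelCount lab s (coneMap v c) =
      if lab v ∈ s then labelCount lab (s.erase (lab v)) c else 0 := by
  by_cases hv : lab v ∈ s
  · rw [if_pos hv]
    have : labelCount lab s ∘ₗ coneMap v = labelCount lab (s.erase (lab v)) :=
      chain_hom_ext fun l => by
        simp only [LinearMap.comp_apply, coneMap_simplexChain, labelCount_simplexChain,
          List.map_cons, ← Multiset.cons_coe]
        obtain ⟨t, rfl⟩ := Multiset.exists_cons_of_mem hv
        simp only [Multiset.erase_cons_head, Multiset.cons_inj_right]
    exact LinearMap.congr_fun this c
  · rw [if_neg hv]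
    have : labelCount lab s ∘ₗ coneMap v = 0 :=
      chain_hom_ext fun l => by
        simp only [LinearMap.comp_apply, coneMap_simplexChain, labelCount_simplexChain,
          List.map_cons, ← Multiset.cons_coe, LinearMap.zero_apply]
        rw [if_neg]
        rintro rfl
        exact hv (Multiset.mem_cons_self _ _)
    exact LinearMap.congr_fun this c

/-- Each vertex contributes the face opposite to it, which has labels `s` iff restoring that
vertex's label `a` gives `a ::ₘ s`. -/
theorem labelCount_simplexBoundary (lab : V → ℕ) (s : Multiset ℕ) (l : List V) :
    labelCount lab s (simplexBoundary l) =
      ((l.map lab).map fun a =>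
        if ((l.map lab : List ℕ) : Multiset ℕ) = a ::ₘ s then (1 : ZMod 2) else 0).sum := by
  induction l generalizing s with
  | nil => simp [simplexBoundary]
  | cons v l ih =>
    simp only [simplexBoundary, map_add, labelCount_simplexChain, labelCount_coneMap, ih,
      List.map_cons, List.sum_cons, ← Multiset.cons_coe, Multiset.cons_inj_right]
    congr 1
    by_cases hv : lab v ∈ s
    · rw [if_pos hv]
      obtain ⟨t, rfl⟩ := Multiset.exists_cons_of_mem hv
      simp only [Multiset.erase_cons_head]
      congr 1
      refine List.map_congr_left fun a _ => ?_
      simp only [Multiset.cons_swap a, Multiset.cons_inj_right]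
    · rw [if_neg hv]
      symm
      refine List.sum_eq_zero fun x hx => ?_
      obtain ⟨a, ha, rfl⟩ := List.mem_map.1 hx
      rw [if_neg]
      intro h
      have h1 : lab v ∈ a ::ₘ s := h ▸ Multiset.mem_cons_self _ _
      rcases Multiset.mem_cons.1 h1 with h2 | h2
      · rw [← h2, Multiset.cons_inj_right] at h
        rw [h2] at hv
        exact hv (h ▸ Multiset.mem_coe.2 ha)
      · exact hv h2

theorem labelCount_range_simplexBoundary (lab : V → ℕ) (k : ℕ) (l : List V)
    (hl : ∀ v ∈ l, lab v ≤ k) :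
    labelCount lab (Multiset.range k) (simplexBoundary l) =
      labelCount lab (Multiset.range (k + 1)) (simplexChain l) := by
  rw [labelCount_simplexBoundary, labelCount_simplexChain, Multiset.range_succ]
  by_cases h : ∃ b, ((l.map lab : List ℕ) : Multiset ℕ) = b ::ₘ Multiset.range k
  · obtain ⟨b, hb⟩ := h
    have hbk : b ≤ k := by
      have : b ∈ l.map lab := Multiset.mem_coe.1 (hb ▸ Multiset.mem_cons_self _ _)
      obtain ⟨v, hv, rfl⟩ := List.mem_map.1 this
      exact hl v hv
    -- The good faces are opposite the vertices labelled `b`: one if `b = k`, and two, which cancel,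
    -- if `b < k`.
    have hcount : ((l.map lab).count b : ZMod 2) = if b = k then 1 else 0 := by
      rw [← Multiset.coe_count, hb, Multiset.count_cons_self]
      split_ifs with h
      · rw [Multiset.count_eq_zero_of_notMem (by simp [h])]
        simp
      · rw [Multiset.count_eq_one_of_mem (Multiset.nodup_range k)
          (Multiset.mem_range.2 (lt_of_le_of_ne hbk h))]
        decide
    rw [hb]
    simp only [Multiset.cons_inj_left]
    rw [← hcount, List.count, List.countP_eq_length_filter]
    induction l.map lab with
    | nil => simp
    | cons a t ih =>
      rw [List.map_cons, List.sum_cons, ih, List.filter_cons]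
      by_cases h : b = a
      · subst h
        simp [add_comm]
      · have : ¬ a = b := fun e => h e.symm
        simp [h, this]
  · push Not at h
    rw [if_neg (h k)]
    refine List.sum_eq_zero fun x hx => ?_
    obtain ⟨a, -, rfl⟩ := List.mem_map.1 hx
    rw [if_neg (h a)]

/-! ### Support conditions on chains. -/

/-- The chains all of whose simplices satisfy `p`. -/
abbrev chainsOn (p : List V → Prop) : Submodule (ZMod 2) (List V →₀ ZMod 2) :=
  Finsupp.supported (ZMod 2) (ZMod 2) {l | p l}

theorem simplexChain_mem_chainsOn {p : List V → Prop} {l : List V} (h : p l) :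
    simplexChain l ∈ chainsOn p :=
  Finsupp.single_mem_supported _ _ h

theorem map_mem_of_mem_chainsOn {M : Type*} [AddCommGroup M] [Module (ZMod 2) M]
    {p : List V → Prop} {c : List V →₀ ZMod 2} (hc : c ∈ chainsOn p)
    (φ : (List V →₀ ZMod 2) →ₗ[ZMod 2] M) (S : Submodule (ZMod 2) M)
    (h : ∀ l, p l → φ (simplexChain l) ∈ S) : φ c ∈ S := by
  rw [chainsOn, Finsupp.supported_eq_span_single] at hc
  have : Submodule.span (ZMod 2) ((fun l : List V => Finsupp.single l (1 : ZMod 2)) '' {l | p l}) ≤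
      S.comap φ := by
    rw [Submodule.span_le]
    rintro _ ⟨l, hl, rfl⟩
    exact h l hl
  exact this hc

theorem labelCount_chainBoundary (lab : V → ℕ) (k : ℕ) {c : List V →₀ ZMod 2}
    (hc : c ∈ chainsOn fun l => ∀ v ∈ l, lab v ≤ k) :
    labelCount lab (Multiset.range k) (chainBoundary c) =
      labelCount lab (Multiset.range (k + 1)) c := by
  have := map_mem_of_mem_chainsOn hc (labelCount lab (Multiset.range k) ∘ₗ chainBoundary -
    labelCount lab (Multiset.range (k + 1))) ⊥ fun l hl => by
      rw [Submodule.mem_bot, LinearMap.sub_apply, LinearMap.comp_apply,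
        chainBoundary_simplexChain, labelCount_range_simplexBoundary lab k l hl, sub_self]
  exact sub_eq_zero.1 this

theorem labelCount_eq_zero (lab : V → ℕ) (s : Multiset ℕ) {c : List V →₀ ZMod 2}
    (hc : c ∈ chainsOn fun l => ∃ a ∈ s, ∀ v ∈ l, lab v ≠ a) : labelCount lab s c = 0 := by
  refine map_mem_of_mem_chainsOn hc (labelCount lab s) ⊥ ?_
  rintro l ⟨a, ha, hl⟩
  rw [Submodule.mem_bot, labelCount_simplexChain, if_neg]
  rintro rfl
  obtain ⟨v, hv, rfl⟩ := List.mem_map.1 (Multiset.mem_coe.1 ha)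
  exact hl v hv rfl

theorem coneMap_mem_chainsOn {p q : List V → Prop} {v : V} {c : List V →₀ ZMod 2}
    (hc : c ∈ chainsOn p) (h : ∀ l, p l → q (v :: l)) : coneMap v c ∈ chainsOn q :=
  map_mem_of_mem_chainsOn hc _ _ fun l hl => by
    rw [coneMap_simplexChain]
    exact simplexChain_mem_chainsOn (h l hl)

theorem vertexMap_mem_chainsOn {p q : List V → Prop} {g : V → V} {c : List V →₀ ZMod 2}
    (hc : c ∈ chainsOn p) (h : ∀ l, p l → q (l.map g)) : vertexMap g c ∈ chainsOn q :=
  map_mem_of_mem_chainsOn hc _ _ fun l hl => by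
    rw [vertexMap_simplexChain]
    exact simplexChain_mem_chainsOn (h l hl)

theorem chainPrism_mem_chainsOn {p q : List V → Prop} {g h : V → V} {c : List V →₀ ZMod 2}
    (hc : c ∈ chainsOn p) (hpq : ∀ l, p l → simplexPrism g h l ∈ chainsOn q) :
    chainPrism g h c ∈ chainsOn q :=
  map_mem_of_mem_chainsOn hc _ _ fun l hl => by
    rw [chainPrism_simplexChain]
    exact hpq l hl

theorem simplexPrism_mem_chainsOn_forall (g h : V → V) (l : List V) :
    simplexPrism g h l ∈ chainsOn fun l' => ∀ v ∈ l', ∃ w ∈ l, v = g w ∨ v = h w := by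
  induction l with
  | nil => simp [simplexPrism]
  | cons v l ih =>
    refine Submodule.add_mem _ (simplexChain_mem_chainsOn ?_) (coneMap_mem_chainsOn ih ?_)
    · simp only [List.mem_cons, List.mem_map]
      rintro u (rfl | rfl | ⟨w, hw, rfl⟩)
      · exact ⟨v, Or.inl rfl, Or.inl rfl⟩
      · exact ⟨v, Or.inl rfl, Or.inr rfl⟩
      · exact ⟨w, Or.inr hw, Or.inr rfl⟩
    · simp only [List.mem_cons]
      rintro l' hl' u (rfl | hu)
      · exact ⟨v, Or.inl rfl, Or.inl rfl⟩
      · obtain ⟨w, hw, h⟩ := hl' u hu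
        exact ⟨w, Or.inr hw, h⟩

theorem simplexPrism_mem_chainsOn_pairwise {r : V → V → Prop} {g h : V → V}
    (hgg : ∀ v w, r v w → r (g v) (g w)) (hhh : ∀ v w, r v w → r (h v) (h w))
    (hgh : ∀ v w, r v w → r (g v) (h w)) (hself : ∀ v, r (g v) (h v))
    {l : List V} (hl : l.Pairwise r) :
    simplexPrism g h l ∈ chainsOn fun l' => l'.Pairwise r := by
  induction l with
  | nil => simp [simplexPrism]
  | cons v l ih =>
    rw [List.pairwise_cons] at hl
    refine Submodule.add_mem _ (simplexChain_mem_chainsOn ?_) ?_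
    · simp only [List.pairwise_cons, List.mem_cons, List.mem_map]
      refine ⟨?_, ?_, hl.2.map _ hhh⟩
      · rintro u (rfl | ⟨w, hw, rfl⟩)
        · exact hself v
        · exact hgh v w (hl.1 w hw)
      · rintro u ⟨w, hw, rfl⟩
        exact hhh v w (hl.1 w hw)
    · have h1 := ih hl.2
      have h2 := simplexPrism_mem_chainsOn_forall g h l
      have h3 : simplexPrism g h l ∈ chainsOn fun l' : List V => l'.Pairwise r ∧
          ∀ v ∈ l', ∃ w ∈ l, v = g w ∨ v = h w := fun x hx => ⟨h1 hx, h2 hx⟩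
      refine coneMap_mem_chainsOn h3 ?_
      rintro l' ⟨ha, hb⟩
      rw [List.pairwise_cons]
      refine ⟨fun u hu => ?_, ha⟩
      obtain ⟨w, hw, rfl | rfl⟩ := hb u hu
      · exact hgg v w (hl.1 w hw)
      · exact hgh v w (hl.1 w hw)

end Chains

/-! ### Sperner's lemma on the triangulated cube. -/

/-- Consecutive vertices of a simplex of the standard triangulation of the lattice. -/
def LatticeStep (v w : ℕ → ℤ) : Prop := ∀ i, v i ≤ w i ∧ w i ≤ v i + 1

/-- The triangulated cube `[0, N]ᵏ` in the first `k` coordinates. -/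
noncomputable def boxChain (N : ℕ) : ℕ → (List (ℕ → ℤ) →₀ ZMod 2)
  | 0 => simplexChain [0]
  | k + 1 => ∑ t ∈ Finset.range N,
      chainPrism (fun v => Function.update v k (t : ℤ)) (fun v => Function.update v k ((t : ℤ) + 1))
        (boxChain N k)

theorem boxChain_mem_chainsOn_zero (N k : ℕ) :
    boxChain N k ∈ chainsOn fun l => ∀ v ∈ l, ∀ i, k ≤ i → v i = 0 := by
  induction k with
  | zero => exact simplexChain_mem_chainsOn (by simp)
  | succ k ih =>
    refine Submodule.sum_mem _ fun t _ => chainPrism_mem_chainsOn ih fun l hl => ?_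
    refine Finsupp.supported_mono (fun l' hl' => ?_) (simplexPrism_mem_chainsOn_forall _ _ l)
    intro v hv i hi
    obtain ⟨w, hw, rfl | rfl⟩ := hl' v hv <;>
    · simp only [Function.update_of_ne (show i ≠ k by omega)]
      exact hl w hw i (by omega)

theorem boxChain_mem_chainsOn_pairwise (N k : ℕ) :
    boxChain N k ∈ chainsOn fun l => l.Pairwise LatticeStep := by
  induction k with
  | zero => exact simplexChain_mem_chainsOn (by simp)
  | succ k ih =>
    have key : ∀ (v w : ℕ → ℤ) (a b : ℤ), LatticeStep v w → a ≤ b → b ≤ a + 1 →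
        LatticeStep (Function.update v k a) (Function.update w k b) := by
      intro v w a b h hab hba i
      by_cases hi : i = k
      · subst hi
        simp [hab, hba]
      · simpa [Function.update_of_ne hi] using h i
    have hrefl : ∀ v, LatticeStep v v := fun v i => ⟨le_rfl, by omega⟩
    refine Submodule.sum_mem _ fun t _ => chainPrism_mem_chainsOn ih fun l hl =>
      simplexPrism_mem_chainsOn_pairwise ?_ ?_ ?_ ?_ hl
    · exact fun v w h => key v w _ _ h le_rfl (by omega)
    · exact fun v w h => key v w _ _ h le_rfl (by omega)
    · exact fun v w h => key v w _ _ h (by omega) le_rfl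
    · exact fun v => key v v _ _ (hrefl v) (by omega) le_rfl

theorem chainBoundary_boxChain_succ (N k : ℕ) :
    chainBoundary (boxChain N (k + 1)) =
      boxChain N k + vertexMap (fun v => Function.update v k (N : ℤ)) (boxChain N k) +
      ∑ t ∈ Finset.range N,
        chainPrism (fun v => Function.update v k (t : ℤ))
          (fun v => Function.update v k ((t : ℤ) + 1)) (chainBoundary (boxChain N k)) := by
  have h0 : vertexMap (fun v => Function.update v k ((0 : ℕ) : ℤ)) (boxChain N k) =
      boxChain N k := by
    refine sub_eq_zero.1 (map_mem_of_mem_chainsOn (boxChain_mem_chainsOn_zero N k)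
      (vertexMap (fun v => Function.update v k ((0 : ℕ) : ℤ)) - LinearMap.id) ⊥ fun l hl => ?_)
    rw [Submodule.mem_bot, LinearMap.sub_apply, vertexMap_simplexChain, LinearMap.id_apply,
      sub_eq_zero]
    congr 1
    conv_rhs => rw [← List.map_id l]
    refine List.map_congr_left fun v hv => ?_
    rw [Nat.cast_zero, ← hl v hv k le_rfl, Function.update_eq_self, id]
  -- The top of each slab is the bottom of the next, so interior faces cancel mod `2`.
  have htel : ∀ M : ℕ, ∑ t ∈ Finset.range M,
      (vertexMap (fun v => Function.update v k (t : ℤ)) (boxChain N k) +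
        vertexMap (fun v => Function.update v k ((t : ℤ) + 1)) (boxChain N k)) =
      vertexMap (fun v => Function.update v k ((0 : ℕ) : ℤ)) (boxChain N k) +
        vertexMap (fun v => Function.update v k (M : ℤ)) (boxChain N k) := by
    intro M
    induction M with
    | zero => simp [chain_add_self]
    | succ M ih =>
      have h := chain_add_self (vertexMap (fun v => Function.update v k (M : ℤ)) (boxChain N k))
      rw [Finset.sum_range_succ, ih, Nat.cast_succ]
      linear_combination (norm := abel) h
  rw [boxChain, map_sum]
  simp only [chainBoundary_chainPrism]
  rw [Finset.sum_add_distrib, htel, h0]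

theorem chainBoundary_boxChain_mem_chainsOn (N k : ℕ) :
    chainBoundary (boxChain N k) ∈ chainsOn fun l : List (ℕ → ℤ) =>
      l = [] ∨ ∃ i < k, (∀ v ∈ l, v i = 0) ∨ ∀ v ∈ l, v i = (N : ℤ) := by
  induction k with
  | zero =>
    rw [boxChain, chainBoundary_simplexChain, simplexBoundary, simplexBoundary, map_zero, add_zero]
    exact simplexChain_mem_chainsOn (Or.inl rfl)
  | succ k ih =>
    rw [chainBoundary_boxChain_succ]
    refine Submodule.add_mem _ (Submodule.add_mem _ ?_ ?_) (Submodule.sum_mem _ fun t _ => ?_)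
    · exact Finsupp.supported_mono (fun l hl => Or.inr ⟨k, k.lt_succ_self, Or.inl fun v hv =>
        hl v hv k le_rfl⟩) (boxChain_mem_chainsOn_zero N k)
    · refine vertexMap_mem_chainsOn (boxChain_mem_chainsOn_zero N k) fun l _ =>
        Or.inr ⟨k, k.lt_succ_self, Or.inr fun v hv => ?_⟩
      obtain ⟨w, -, rfl⟩ := List.mem_map.1 hv
      exact Function.update_self ..
    · refine chainPrism_mem_chainsOn ih ?_
      -- The empty simplex comes from the augmentation; its prism is zero.
      rintro l (rfl | ⟨i, hik, h⟩)
      · exact Submodule.zero_mem _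
      · refine Finsupp.supported_mono (fun l' hl' => Or.inr ⟨i, by omega, ?_⟩)
          (simplexPrism_mem_chainsOn_forall _ _ l)
        refine h.imp (fun h v hv => ?_) (fun h v hv => ?_) <;>
        · obtain ⟨w, hw, rfl | rfl⟩ := hl' v hv <;>
          · simp only [Function.update_of_ne hik.ne]
            exact h w hw

/-- Sperner's lemma for the triangulated cube. -/
theorem exists_fully_labelled_simplex {n N : ℕ} {lab : (ℕ → ℤ) → ℕ} (hle : ∀ v, lab v ≤ n)
    (h0 : ∀ v : ℕ → ℤ, ∀ i < n, v i = 0 → lab v ≤ i) (hN : ∀ v : ℕ → ℤ, ∀ i < n, v i = (N : ℤ) → lab v ≠ i) :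
    ∃ l : List (ℕ → ℤ), l.Pairwise LatticeStep ∧
      ((l.map lab : List ℕ) : Multiset ℕ) = Multiset.range (n + 1) := by
  have hlab : ∀ k ≤ n, ∀ v : ℕ → ℤ, (∀ i, k ≤ i → v i = 0) → lab v ≤ k := by
    intro k hk v hv
    rcases hk.lt_or_eq with h | rfl
    · exact h0 v k h (hv k le_rfl)
    · exact hle v
  have hcount : ∀ k ≤ n, labelCount lab (Multiset.range (k + 1)) (boxChain N k) = 1 := by
    intro k hk
    induction k with
    | zero =>
      have : lab 0 = 0 := Nat.le_zero.1 (hlab 0 hk 0 fun _ _ => rfl)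
      rw [boxChain, labelCount_simplexChain, if_pos]
      simp [this]
    | succ k ih =>
      -- Only the bottom face counts: the top misses label `k`, the sides `v i = 0` have labels at
      -- most `i < k`, and the sides `v i = N` miss label `i`.
      rw [← labelCount_chainBoundary lab (k + 1) (Finsupp.supported_mono
        (fun l (hl : ∀ v ∈ l, _) v hv => hlab (k + 1) hk v (hl v hv)) (boxChain_mem_chainsOn_zero N (k + 1))),
        chainBoundary_boxChain_succ, map_add, map_add, ih (by omega),
        labelCount_eq_zero lab _ (vertexMap_mem_chainsOn (boxChain_mem_chainsOn_zero N k)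
          fun l _ => ⟨k, Multiset.mem_range.2 k.lt_succ_self, fun v hv => ?_⟩), map_sum,
        Finset.sum_eq_zero fun t _ => ?_, add_zero, add_zero]
      · refine labelCount_eq_zero lab _ (chainPrism_mem_chainsOn
          (chainBoundary_boxChain_mem_chainsOn N k) ?_)
        rintro l (rfl | ⟨i, hik, h⟩)
        · exact Submodule.zero_mem _
        refine Finsupp.supported_mono (fun l' hl' => ?_) (simplexPrism_mem_chainsOn_forall _ _ l)
        rcases h with h | h
        · refine ⟨k, Multiset.mem_range.2 k.lt_succ_self, fun v hv => ?_⟩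
          have : v i = 0 := by
            obtain ⟨w, hw, rfl | rfl⟩ := hl' v hv <;>
            · simp only [Function.update_of_ne hik.ne]
              exact h w hw
          have := h0 v i (by omega) this
          omega
        · refine ⟨i, Multiset.mem_range.2 (by omega), fun v hv => hN v i (by omega) ?_⟩
          obtain ⟨w, hw, rfl | rfl⟩ := hl' v hv <;>
          · simp only [Function.update_of_ne hik.ne]
            exact h w hw
      · obtain ⟨w, -, rfl⟩ := List.mem_map.1 hv
        exact hN _ k hk (Function.update_self ..)
  by_contra! hcon
  have : labelCount lab (Multiset.range (n + 1)) (boxChain N n) ∈ (⊥ : Submodule (ZMod 2) _) :=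
    map_mem_of_mem_chainsOn (boxChain_mem_chainsOn_pairwise N n) _ ⊥ fun l hl => by
      rw [Submodule.mem_bot, labelCount_simplexChain, if_neg (hcon l hl)]
  rw [hcount n le_rfl, Submodule.mem_bot] at this
  exact one_ne_zero this

/-! ### Lower bound and conclusion. -/

/-- The vertices of the monochromatic component of `x`. -/
def cluster {V α : Type*} (G : SimpleGraph V) (f : V → α) (x : V) : Set V :=
  componentVertices ((G.induce (f ⁻¹' {f x})).connectedComponentMk ⟨x, rfl⟩)

theorem mem_cluster_self {V α : Type*} (G : SimpleGraph V) (f : V → α) (x : V) :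
    x ∈ cluster G f x :=
  ⟨⟨x, rfl⟩, rfl, rfl⟩

theorem cluster_eq_of_adj {V α : Type*} {G : SimpleGraph V} {f : V → α} {x y : V}
    (h : G.Adj x y) (hf : f x = f y) : cluster G f x = cluster G f y := by
  have key : ∀ (i j : α) (hx : x ∈ f ⁻¹' {i}) (hy : y ∈ f ⁻¹' {j}), i = j →
      componentVertices ((G.induce (f ⁻¹' {i})).connectedComponentMk ⟨x, hx⟩) =
      componentVertices ((G.induce (f ⁻¹' {j})).connectedComponentMk ⟨y, hy⟩) := by
    rintro i _ hx hy rfl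
    congr 1
    exact SimpleGraph.ConnectedComponent.sound
      (SimpleGraph.Adj.reachable (SimpleGraph.comap_adj.2 h))
  exact key _ _ _ _ hf

/-- A path inside the cluster repeats no vertex, so it has fewer than `K` edges, each changing a
coordinate by at most `1`. -/
theorem abs_sub_lt_of_mem_cluster {n K : ℕ} {α : Type*} {f : (Fin n → ℤ) → α} {x y : Fin n → ℤ}
    (hK : (cluster (kingGraph n) f x).encard ≤ K) (hy : y ∈ cluster (kingGraph n) f x)
    (i : Fin n) : |x i - y i| < K := by
  obtain ⟨y, hy, rfl⟩ := hy
  obtain ⟨p⟩ := SimpleGraph.ConnectedComponent.exact hy.symm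
  classical
  let q := p.toPath
  have h1 : (q.1.support.map Subtype.val).Nodup := q.2.support_nodup.map Subtype.val_injective
  have h2 : ((q.1.support.map Subtype.val).toFinset : Set (Fin n → ℤ)) ⊆
      cluster (kingGraph n) f x := by
    intro z hz
    rw [Finset.mem_coe, List.mem_toFinset, List.mem_map] at hz
    obtain ⟨z, hz, rfl⟩ := hz
    exact ⟨z, SimpleGraph.ConnectedComponent.sound (q.1.takeUntil z hz).reachable.symm, rfl⟩
  have h3 := (Set.encard_le_encard h2).trans hK
  rw [Set.encard_coe_eq_coe_finsetCard, List.toFinset_card_of_nodup h1, List.length_map,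
    SimpleGraph.Walk.length_support] at h3
  have h4 : q.1.length + 1 ≤ K := by exact_mod_cast h3
  have h5 := abs_sub_le_length_of_walk
    (q.1.map (SimpleGraph.Embedding.induce (G := kingGraph n) _).toHom) i
  rw [SimpleGraph.Walk.length_map] at h5
  exact lt_of_le_of_lt h5 (by omega)

/-- The lattice has no colouring with `k ≤ n` colours and bounded monochromatic components. -/
theorem lt_of_encard_cluster_le {n k K : ℕ} (f : (Fin n → ℤ) → Fin k)
    (hK : ∀ x, (cluster (kingGraph n) f x).encard ≤ K) : n < k := by
  by_contra! hkn
  let ρ : (ℕ → ℤ) → Fin n → ℤ := fun u i => u i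
  -- Including `n` keeps the set nonempty, so `sInf` is a true minimum and at most `n`.
  let S : (ℕ → ℤ) → Set ℕ := fun u =>
    {i | i = n ∨ ∃ h : i < n, ∃ y ∈ cluster (kingGraph n) f (ρ u), y ⟨i, h⟩ ≤ 0}
  obtain ⟨l, hl, hlab⟩ := exists_fully_labelled_simplex (n := n) (N := K)
    (lab := fun u => sInf (S u)) (fun u => Nat.sInf_le (Or.inl rfl))
    (fun u i hi hu => Nat.sInf_le (Or.inr ⟨hi, ρ u, mem_cluster_self _ _ _, hu.le⟩))
    (fun u i hi hu he => by
      have hmem : sInf (S u) ∈ S u := Nat.sInf_mem ⟨n, Or.inl rfl⟩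
      rw [show sInf (S u) = i from he] at hmem
      obtain h | ⟨h, y, hy, hyi⟩ := hmem
      · omega
      · have h1 := abs_sub_lt_of_mem_cluster (hK _) hy ⟨i, h⟩
        have h2 : ρ u ⟨i, h⟩ = K := hu
        rw [h2, abs_lt] at h1
        omega)
  have hlen : l.length = n + 1 := by
    simpa using congrArg Multiset.card hlab
  have hnodup : (l.map fun u => sInf (S u)).Nodup := by
    rw [← Multiset.coe_nodup, hlab]
    exact Multiset.nodup_range _
  -- Two vertices of equal colour would share a cluster, hence a label.
  have hcol : (l.map fun u => f (ρ u)).Nodup := by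
    rw [List.Nodup, List.pairwise_map] at hnodup ⊢
    refine (hl.and hnodup).imp fun {u v} ⟨huv, hne⟩ hf => hne ?_
    have hC : cluster (kingGraph n) f (ρ u) = cluster (kingGraph n) f (ρ v) := by
      by_cases he : ρ u = ρ v
      · rw [he]
      · refine cluster_eq_of_adj (kingGraph_adj_iff.2 ⟨he, fun i => ?_⟩) hf
        have := huv i
        change |u i - v i| ≤ 1
        rw [abs_le]
        omega
    simp only [S, hC]
  have := hcol.length_le_card
  rw [List.length_map, hlen, Fintype.card_fin] at this
  omega

theorem mainTheorem3 (n m : ℕ) (hn : 1 ≤ n) (hm : 1 ≤ m) :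
    clusteredChromaticNumber (kingGraph n) m = ((n + 1 : ℕ) : ℕ∞) ∧
      optimalClusterSize (kingGraph n) m ≤ ((n.factorial * m ^ n : ℕ) : ℕ∞) := by
  obtain ⟨f, hf⟩ := exists_clusteredColoring_kingGraph n m hm
  have hpos : 0 < n.factorial * m ^ n := by positivity
  have hchi : clusteredChromaticNumber (kingGraph n) m = ((n + 1 : ℕ) : ℕ∞) := by
    refine le_antisymm (iInf₂_le (n + 1) ⟨by omega, f, _, hpos, hf⟩) (le_iInf₂ fun k hk => ?_)
    obtain ⟨-, g, K, -, hg⟩ := hk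
    exact_mod_cast lt_of_encard_cluster_le g fun x => (hg (g x)).1 _
  exact ⟨hchi, iInf₂_le (n.factorial * m ^ n) ⟨hpos, n + 1, hchi.symm, f, hf⟩⟩
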